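/- Let $(\Omega,\mu)$ be a $\sigma$-finite measure space with $\mu$ non-atomic, and let $\mathcal M(\Omega,\mu)$ be the space of (classes modulo $\mu$-a.e. equality of) $\mu$-measurable scalar-valued (real or complex) functions on $\Omega$. For $f\in\mathcal M(\Omega,\mu)$ let $f^*(t)=\inf\{\lambda\ge 0:\mu(\{|f|>\lambda\})\le t\}$, $t>0$ (with $\inf\emptyset=\infty$), be its non-increasing rearrangement. Write $\|\cdot\|_{q,(\alpha,\beta)}$ for the (quasi-)norm of the Lebesgue space $L_q$ on the interval $(\alpha,\beta)$, $0<q\le\infty$, and put $1/\infty=0$, $1/0=\infty$. A positive Lebesgue measurable function $b$ on $(0,\infty)$ is called slowly varying, $b\in SV$, if for each $\varepsilon>0$ the function $t\mapsto t^{\varepsilon}b(t)$ is equivalent to a non-decreasing function and $t\mapsto t^{-\varepsilon}b(t)$ is equivalent to a non-increasing function on $(0,\infty)$, where $g\approx h$ means $C^{-1}g\le h\le Cg$ on $(0,\infty)$ for some constant $C>0$. For $0<p,q\le\infty$ let $L_p$ be the Lebesgue space on $(\Omega,\mu)$ and let $L_{p,q}$ be the Lorentz space with quasi-norm $\|f\|_{p,q}=\|t^{\frac1p-\frac1q}f^*(t)\|_{q,(0,\infty)}$.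 For a couple $(A_0,A_1)$ of quasi-normed subspaces of $\mathcal M(\Omega,\mu)$ and $t>0$, let $$K(t,f;A_0,A_1)=\inf\{\|f_0\|_{A_0}+t\|f_1\|_{A_1}: f=f_0+f_1,\ f_i\in A_i,\ i=0,1\}.$$ For $0\le\theta\le1$, $0<s,r,q\le\infty$ and $a,b,c\in SV$, the extremal interpolation space $(A_0,A_1)^{\mathcal L,\mathcal L}_{\theta,s,c,r,b,q,a}$ is the set of all $f\in A_0+A_1$ for which the quasi-norm $$\bigg\|t^{-\frac1s}c(t)\Big\|u^{-\frac1r}b(u)\big\|v^{-\theta-\frac1q}a(v)K(v,f;A_0,A_1)\big\|_{q,(0,u)}\Big\|_{r,(0,t)}\bigg\|_{s,(0,\infty)}$$ is finite. For $0<p\le\infty$, the $\mathcal L\mathcal L$ Lorentz–Karamata space $L^{\mathcal L,\mathcal L}_{p,(s,c,r,b,q,a)}$ is the set of all $f\in\mathcal M(\Omega,\mu)$ for which the quasi-norm $$\bigg\|t^{-\frac1s}c(t)\Big\|u^{-\frac1r}b(u)\big\|v^{\frac1p-\frac1q}a(v)f^*(v)\big\|_{q,(0,u)}\Big\|_{r,(0,t)}\bigg\|_{s,(0,\infty)}$$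 is finite. Two quasi-normed spaces are called equal if they have the same elements and their quasi-norms are equivalent. **Theorem.** Let $0<\theta\le1$, $0<\varkappa<\infty$, $p=\frac{\varkappa}{1-\theta}$ (so $p=\infty$ if $\theta=1$), $0<q,r,s\le\infty$ and $a,b,c\in SV$. Put $\tilde a(t)=a(t^{1/\varkappa})$, $\tilde b(t)=b(t^{1/\varkappa})$, $\tilde c(t)=c(t^{1/\varkappa})$ for $t>0$. Then $$(L_\varkappa,L_\infty)^{\mathcal L,\mathcal L}_{\theta,s,c,r,b,q,a}=(L_{\varkappa,\infty},L_\infty)^{\mathcal L,\mathcal L}_{\theta,s,c,r,b,q,a}=L^{\mathcal L,\mathcal L}_{p,(s,\tilde c,r,\tilde b,q,\tilde a)},$$ with equality of sets and equivalence of quasi-norms. -/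

import Mathlib

open MeasureTheory Set
open scoped ENNReal NNReal

noncomputable section

namespace LorentzKaramata

/-- Slowly varying functions on `(0,∞)`: positive, Lebesgue measurable, and for every `ε > 0`,
`t ^ ε * b t` is equivalent to a non-decreasing function and `t ^ (-ε) * b t` is equivalent to a
non-increasing function on `(0,∞)`. Values of `b` outside `(0,∞)` are irrelevant. -/
structure SlowlyVarying (b : ℝ → ℝ) : Prop where
  pos : ∀ t, 0 < t → 0 < b t
  measurable : AEMeasurable b (volume.restrict (Ioi 0))
  equiv_mono : ∀ ε : ℝ, 0 < ε → ∃ (g : ℝ → ℝ) (C : ℝ), MonotoneOn g (Ioi 0) ∧ 0 < C ∧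
    ∀ t, 0 < t → t ^ ε * b t ≤ C * g t ∧ g t ≤ C * (t ^ ε * b t)
  equiv_anti : ∀ ε : ℝ, 0 < ε → ∃ (g : ℝ → ℝ) (C : ℝ), AntitoneOn g (Ioi 0) ∧ 0 < C ∧
    ∀ t, 0 < t → t ^ (-ε) * b t ≤ C * g t ∧ g t ≤ C * (t ^ (-ε) * b t)

/-- The measure `μ` has no atoms in the measure-theoretic sense: every measurable set of positive
measure has a measurable subset of strictly smaller positive measure. -/
def NonAtomic {Ω : Type*} [MeasurableSpace Ω] (μ : Measure Ω) : Prop :=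
  ∀ A : Set Ω, MeasurableSet A → 0 < μ A → ∃ B ⊆ A, MeasurableSet B ∧ 0 < μ B ∧ μ B < μ A

/-- A (quasi-)normed space sitting inside an ambient vector space `V`, recorded by its set of
elements and its quasi-norm. The quasi-norm takes values in `[0,∞]`; only its values on `carrier`
matter. -/
structure QSpace (V : Type*) where
  carrier : Set V
  qnorm : V → ℝ≥0∞

/-- Continuous embedding `X ⊂ Y`. -/
def QSpace.Embeds {V : Type*} (X Y : QSpace V) : Prop :=
  X.carrier ⊆ Y.carrier ∧ ∃ C : ℝ≥0, ∀ f ∈ X.carrier, Y.qnorm f ≤ C * X.qnorm f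

/-- Equality of quasi-normed spaces: the same elements and equivalent quasi-norms. -/
def QSpace.Identical {V : Type*} (X Y : QSpace V) : Prop :=
  X.Embeds Y ∧ Y.Embeds X

/-- The weighted quasi-norm `‖ t ^ (α - 1/q) w(t) F(t) ‖_{q, I}`, with `1/∞ = 0`. -/
def wnorm (q : ℝ≥0∞) (α : ℝ) (w : ℝ → ℝ) (F : ℝ → ℝ≥0∞) (I : Set ℝ) : ℝ≥0∞ :=
  eLpNorm (fun t : ℝ => ENNReal.ofReal (t ^ (α - (q⁻¹).toReal) * w t) * F t) q
    (volume.restrict I)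

/-- The iterated quasi-norm
`‖ t^(-1/s) c(t) ‖ u^(-1/r) b(u) ‖ v^(α-1/q) a(v) F(v) ‖_{q,(0,u)} ‖_{r,(0,t)} ‖_{s,(0,∞)}`. -/
def llNorm (α : ℝ) (s : ℝ≥0∞) (c : ℝ → ℝ) (r : ℝ≥0∞) (b : ℝ → ℝ) (q : ℝ≥0∞) (a : ℝ → ℝ)
    (F : ℝ → ℝ≥0∞) : ℝ≥0∞ :=
  wnorm s 0 c (fun t => wnorm r 0 b (fun u => wnorm q α a F (Ioo 0 u)) (Ioo 0 t)) (Ioi 0)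

/-- The sum `A₀ + A₁` of two spaces inside the same ambient space. -/
def sumSet {V : Type*} [Add V] (A₀ A₁ : QSpace V) : Set V :=
  {f | ∃ f₀ ∈ A₀.carrier, ∃ f₁ ∈ A₁.carrier, f = f₀ + f₁}

/-- Peetre's `K`-functional `K(t, f; A₀, A₁)`. -/
def kFunctional {V : Type*} [Add V] (A₀ A₁ : QSpace V) (t : ℝ) (f : V) : ℝ≥0∞ :=
  ⨅ (f₀ ∈ A₀.carrier) (f₁ ∈ A₁.carrier) (_ : f = f₀ + f₁),
    A₀.qnorm f₀ + ENNReal.ofReal t * A₁.qnorm f₁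

/-- The extremal interpolation space `(A₀, A₁)^{𝓛,𝓛}_{θ,s,c,r,b,q,a}`. -/
def llInterpolation {V : Type*} [Add V] (A₀ A₁ : QSpace V) (θ : ℝ)
    (s : ℝ≥0∞) (c : ℝ → ℝ) (r : ℝ≥0∞) (b : ℝ → ℝ) (q : ℝ≥0∞) (a : ℝ → ℝ) : QSpace V where
  carrier := {f | f ∈ sumSet A₀ A₁ ∧
    llNorm (-θ) s c r b q a (fun v => kFunctional A₀ A₁ v f) < ∞}
  qnorm f := llNorm (-θ) s c r b q a (fun v => kFunctional A₀ A₁ v f)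

section FunctionSpaces

variable {Ω : Type*} [MeasurableSpace Ω] (𝕜 : Type*) [RCLike 𝕜] (μ : Measure Ω)

variable {𝕜 μ} in
/-- The non-increasing rearrangement `f^*(t) = inf {l ≥ 0 : μ {|f| > l} ≤ t}` (with `inf ∅ = ∞`)
of a (class of a) measurable function. -/
def rearrangement (f : Ω →ₘ[μ] 𝕜) (t : ℝ) : ℝ≥0∞ :=
  sInf {l : ℝ≥0∞ | μ {x | l < ‖f x‖ₑ} ≤ ENNReal.ofReal t}

/-- The Lebesgue space `L_p`, `0 < p ≤ ∞`. -/
def lebesgueSpace (p : ℝ≥0∞) : QSpace (Ω →ₘ[μ] 𝕜) where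
  carrier := {f | eLpNorm f p μ < ∞}
  qnorm f := eLpNorm f p μ

/-- The Lorentz space `L_{p,q}`, with quasi-norm `‖ t^(1/p-1/q) f^*(t) ‖_{q,(0,∞)}`. -/
def lorentzSpace (p q : ℝ≥0∞) : QSpace (Ω →ₘ[μ] 𝕜) where
  carrier := {f | wnorm q (p⁻¹).toReal (fun _ => 1) (rearrangement f) (Ioi 0) < ∞}
  qnorm f := wnorm q (p⁻¹).toReal (fun _ => 1) (rearrangement f) (Ioi 0)

/-- The `𝓛𝓛` Lorentz–Karamata space `L^{𝓛,𝓛}_{p,(s,c,r,b,q,a)}`. -/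
def llSpace (p : ℝ≥0∞) (s : ℝ≥0∞) (c : ℝ → ℝ) (r : ℝ≥0∞) (b : ℝ → ℝ) (q : ℝ≥0∞) (a : ℝ → ℝ) :
    QSpace (Ω →ₘ[μ] 𝕜) where
  carrier := {f | llNorm (p⁻¹).toReal s c r b q a (rearrangement f) < ∞}
  qnorm f := llNorm (p⁻¹).toReal s c r b q a (rearrangement f)

end FunctionSpaces

/-- The function `t ↦ b (t ^ (1/κ))`. -/
def dil (κ : ℝ) (b : ℝ → ℝ) : ℝ → ℝ := fun t => b (t ^ (1 / κ))

end LorentzKaramata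

end

namespace LorentzKaramata

/-! The three spaces are embedded in each other cyclically, all compared through X(v) = v f*(v^κ).
The substitution t = x^κ (`llNorm_dil`) turns the Lorentz–Karamata quasi-norm into a constant times
the iterated quasi-norm of X, with exponent -θ and the original weights. Chebyshev's inequality
makes the weak K-functional at most the strong one, and splitting f = f₀ + f₁ gives X(v) ≤ K(v, f;
L_{κ,∞}, L_∞).

The substantial step bounds the strong K-functional by X in the innermost norm on each (0,u); the
outer norms are monotone. Truncating f at height f*(v^κ) and slicing the upper part at the heights
f*((2^{-j}v)^κ) bounds K(v, f; L_κ, L_∞) by a multiple of sup_j ρ^{-j} X(2^{-j}v) for any 0 < ρ < 1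
(`kFunctional_lebesgue_le`). With ρ = 2^{-θ/3}, slow variation and θ > 0 give v^{-θ}a(v) a gain of
ρ^{2j} on passing to 2^{-j}v. One factor ρ^j cancels the loss; the other makes the supremum of
dilates bounded in the scale-invariant norm (`wnorm_iSup_dyadic_le`). This replaces Hardy's
inequality and works for all q > 0. -/

/-! ### Weighted quasi-norms -/

theorem wnorm_mono {q : ℝ≥0∞} {α : ℝ} {w : ℝ → ℝ} {F G : ℝ → ℝ≥0∞} {I : Set ℝ}
    (hI : MeasurableSet I) (C : ℝ≥0) (h : ∀ t ∈ I, F t ≤ C * G t) :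
    wnorm q α w F I ≤ C * wnorm q α w G I := by
  unfold wnorm
  rw [← smul_eq_mul, ← ENNReal.smul_def]
  refine eLpNorm_le_nnreal_smul_eLpNorm_of_ae_le_mul' ?_ q
  filter_upwards [ae_restrict_mem hI] with t ht
  simp only [enorm_eq_self]
  calc _ ≤ _ := mul_le_mul_right (h t ht) _
    _ = _ := by ring

theorem wnorm_congr {q : ℝ≥0∞} {α β : ℝ} {w v : ℝ → ℝ} {F G : ℝ → ℝ≥0∞} {I : Set ℝ}
    (hI : MeasurableSet I)
    (h : ∀ t ∈ I, ENNReal.ofReal (t ^ (α - (q⁻¹).toReal) * w t) * F t =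
      ENNReal.ofReal (t ^ (β - (q⁻¹).toReal) * v t) * G t) :
    wnorm q α w F I = wnorm q β v G I := by
  unfold wnorm
  refine eLpNorm_congr_ae ?_
  filter_upwards [ae_restrict_mem hI] with t ht using h t ht

/-- The power of the weight and the function `w` may be absorbed into `F`. -/
theorem wnorm_eq_unit_weight (q : ℝ≥0∞) (α : ℝ) (w : ℝ → ℝ) (F : ℝ → ℝ≥0∞) {I : Set ℝ}
    (hI : MeasurableSet I) (hI0 : I ⊆ Ioi 0) :
    wnorm q α w F I =
      wnorm q 0 (fun _ => 1) (fun t => ENNReal.ofReal (t ^ α * w t) * F t) I := by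
  refine wnorm_congr hI fun t ht => ?_
  have ht0 : 0 < t := hI0 ht
  rw [← mul_assoc, ← ENNReal.ofReal_mul (by positivity), mul_one, ← mul_assoc,
    ← Real.rpow_add ht0]
  congr 4
  ring

theorem wnorm_const_mul {q : ℝ≥0∞} {α : ℝ} {w : ℝ → ℝ} {F : ℝ → ℝ≥0∞} {I : Set ℝ}
    (hI : MeasurableSet I) {C : ℝ≥0} (hC : C ≠ 0) :
    wnorm q α w (fun t => C * F t) I = C * wnorm q α w F I := by
  refine le_antisymm (wnorm_mono hI C fun t _ => le_rfl) ?_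
  have hC' : (C : ℝ≥0∞) ≠ 0 := by simpa using hC
  calc (C : ℝ≥0∞) * wnorm q α w F I
      ≤ C * ((C⁻¹ : ℝ≥0) * wnorm q α w (fun t => C * F t) I) := by
        gcongr
        refine wnorm_mono hI C⁻¹ fun t _ => ?_
        rw [ENNReal.coe_inv hC, ← mul_assoc, ENNReal.inv_mul_cancel hC' (by simp), one_mul]
    _ = _ := by
        rw [ENNReal.coe_inv hC, ← mul_assoc, ENNReal.mul_inv_cancel hC' (by simp), one_mul]

/-! ### Power substitutions -/

theorem hasDerivAt_const_mul_rpow (l κ : ℝ) {x : ℝ} (hx : 0 < x) :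
    HasDerivAt (fun x : ℝ => l * x ^ κ) (l * (κ * x ^ (κ - 1))) x :=
  (Real.hasDerivAt_rpow_const (Or.inl hx.ne')).const_mul l

theorem const_mul_rpow_leftInv {l κ : ℝ} (hl : 0 < l) (hκ : 0 < κ) {x : ℝ} (hx : 0 < x) :
    l⁻¹ ^ (1 / κ) * (l * x ^ κ) ^ (1 / κ) = x := by
  rw [Real.mul_rpow hl.le (by positivity), ← Real.rpow_mul hx.le, mul_one_div_cancel hκ.ne',
    Real.rpow_one, ← mul_assoc, ← Real.mul_rpow (by positivity) hl.le, inv_mul_cancel₀ hl.ne',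
    Real.one_rpow, one_mul]

/-- The substitution and its inverse are differentiable where needed, so both send null sets to null
sets and the essential upper bounds agree. No measurability of `G` is required. -/
theorem essSup_image_const_mul_rpow {l κ : ℝ} (hl : 0 < l) (hκ : 0 < κ) {I : Set ℝ}
    (hI : MeasurableSet I) (hI0 : I ⊆ Ioi 0) (G : ℝ → ℝ≥0∞) :
    essSup G (volume.restrict ((fun x : ℝ => l * x ^ κ) '' I)) =
      essSup (fun x => G (l * x ^ κ)) (volume.restrict I) := by
  set φ : ℝ → ℝ := fun x => l * x ^ κ with hφ
  have hinv : ∀ x ∈ I, l⁻¹ ^ (1 / κ) * (φ x) ^ (1 / κ) = x :=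
    fun x hx => const_mul_rpow_leftInv hl hκ (hI0 hx)
  have hinj : InjOn φ I := fun x hx y hy h => by rw [← hinv x hx, h, hinv y hy]
  have hmeas : MeasurableSet (φ '' I) :=
    hI.image_of_continuousOn_injOn
      (fun x hx => (hasDerivAt_const_mul_rpow l κ (hI0 hx)).continuousAt.continuousWithinAt) hinj
  have key : ∀ A : ℝ≥0∞, (∀ᵐ y ∂(volume.restrict (φ '' I)), G y ≤ A) ↔
      ∀ᵐ x ∂(volume.restrict I), G (φ x) ≤ A := by
    intro A
    rw [ae_restrict_iff' hmeas, ae_restrict_iff' hI, ae_iff, ae_iff]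
    have himg : {y | ¬(y ∈ φ '' I → G y ≤ A)} = φ '' {x | ¬(x ∈ I → G (φ x) ≤ A)} := by
      ext y
      constructor
      · intro hy
        simp only [mem_ofPred_eq, Classical.not_imp] at hy
        obtain ⟨⟨x, hx, rfl⟩, hG⟩ := hy
        exact ⟨x, by simp only [mem_ofPred_eq, Classical.not_imp]; exact ⟨hx, hG⟩, rfl⟩
      · rintro ⟨x, hx, rfl⟩
        simp only [mem_ofPred_eq, Classical.not_imp] at hx ⊢
        exact ⟨⟨x, hx.1, rfl⟩, hx.2⟩
    have hsub : {x | ¬(x ∈ I → G (φ x) ≤ A)} ⊆ I := fun x hx => by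
      simp only [mem_ofPred_eq, Classical.not_imp] at hx
      exact hx.1
    constructor
    · intro h
      have hpre : {x | ¬(x ∈ I → G (φ x) ≤ A)} =
          (fun y : ℝ => l⁻¹ ^ (1 / κ) * y ^ (1 / κ)) '' {y | ¬(y ∈ φ '' I → G y ≤ A)} := by
        rw [himg, image_image]
        symm
        convert image_id _ using 1
        exact image_congr fun x hx => hinv x (hsub hx)
      rw [hpre]
      refine addHaar_image_eq_zero_of_differentiableOn_of_addHaar_eq_zero _ ?_ h
      intro y hy
      rw [himg] at hy
      obtain ⟨x, hx, rfl⟩ := hy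
      have hx0 : 0 < x := hI0 (hsub hx)
      exact (hasDerivAt_const_mul_rpow _ _ (by positivity)).differentiableAt.differentiableWithinAt
    · intro h
      rw [himg]
      refine addHaar_image_eq_zero_of_differentiableOn_of_addHaar_eq_zero _ ?_ h
      intro x hx
      exact (hasDerivAt_const_mul_rpow _ _
        (hI0 (hsub hx))).differentiableAt.differentiableWithinAt
  refine le_antisymm ?_ ?_
  · exact essSup_le_of_ae_le _ ((key _).2 (ae_le_essSup (f := fun x => G (φ x))))
  · exact essSup_le_of_ae_le _ ((key _).1 (ae_le_essSup (f := G)))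

/-- Change of variables `y = l x ^ κ` in the scale-invariant norms. -/
theorem wnorm_image_const_mul_rpow {q : ℝ≥0∞} (hq : 0 < q) {l κ : ℝ} (hl : 0 < l) (hκ : 0 < κ)
    {I : Set ℝ} (hI : MeasurableSet I) (hI0 : I ⊆ Ioi 0) (G : ℝ → ℝ≥0∞) :
    wnorm q 0 (fun _ => 1) G ((fun x : ℝ => l * x ^ κ) '' I) =
      ENNReal.ofReal κ ^ (q⁻¹).toReal *
        wnorm q 0 (fun _ => 1) (fun x => G (l * x ^ κ)) I := by
  unfold wnorm
  rcases eq_or_ne q ∞ with rfl | hq'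
  · simp only [ENNReal.inv_top, ENNReal.toReal_zero, sub_zero, Real.rpow_zero, mul_one,
      ENNReal.ofReal_one, one_mul, ENNReal.rpow_zero, eLpNorm_exponent_top,
      eLpNormEssSup_eq_essSup_enorm, enorm_eq_self]
    exact essSup_image_const_mul_rpow hl hκ hI hI0 G
  have hq0 : 0 < q.toReal := ENNReal.toReal_pos hq.ne' hq'
  have hinj : InjOn (fun x : ℝ => l * x ^ κ) I := fun x hx y hy h => by
    simp only at h
    rw [← const_mul_rpow_leftInv hl hκ (hI0 hx), h, const_mul_rpow_leftInv hl hκ (hI0 hy)]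
  rw [eLpNorm_eq_lintegral_rpow_enorm_toReal hq.ne' hq',
    eLpNorm_eq_lintegral_rpow_enorm_toReal hq.ne' hq',
    lintegral_image_eq_lintegral_abs_deriv_mul hI
      (fun x hx => (hasDerivAt_const_mul_rpow l κ (hI0 hx)).hasDerivWithinAt) hinj,
    ENNReal.toReal_inv, one_div, ← ENNReal.mul_rpow_of_nonneg _ _ (by positivity),
    ← lintegral_const_mul' _ _ ENNReal.ofReal_ne_top]
  congr 1
  refine setLIntegral_congr_fun hI fun x hx => ?_
  have hx0 : 0 < x := hI0 hx
  simp only [enorm_eq_self, mul_one, zero_sub]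
  rw [ENNReal.mul_rpow_of_nonneg _ _ hq0.le, ENNReal.mul_rpow_of_nonneg _ _ hq0.le,
    ENNReal.ofReal_rpow_of_pos (by positivity), ENNReal.ofReal_rpow_of_pos (by positivity),
    ← Real.rpow_mul (by positivity), ← Real.rpow_mul (by positivity),
    ← mul_assoc (ENNReal.ofReal _), ← mul_assoc (ENNReal.ofReal κ),
    ← ENNReal.ofReal_mul (by positivity), ← ENNReal.ofReal_mul (by positivity)]
  -- Weight times Jacobian: (l x^κ)⁻¹ · lκ x^(κ-1) = κ x⁻¹, so `l` drops out.
  congr 2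
  rw [neg_mul, inv_mul_cancel₀ hq0.ne', abs_of_pos (by positivity), Real.rpow_neg_one,
    Real.rpow_neg_one, Real.rpow_sub_one hx0.ne']
  field_simp

theorem image_const_mul_Ioo {l : ℝ} (hl : 0 < l) (u : ℝ) :
    (fun x : ℝ => l * x ^ (1 : ℝ)) '' Ioo 0 u = Ioo 0 (l * u) := by
  simp only [Real.rpow_one]
  rw [image_mul_left_Ioo hl, mul_zero]

theorem image_rpow_Ioi {κ : ℝ} (hκ : 0 < κ) :
    (fun x : ℝ => 1 * x ^ κ) '' Ioi 0 = Ioi 0 := by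
  ext y
  simp only [one_mul, mem_image, mem_Ioi]
  constructor
  · rintro ⟨x, hx, rfl⟩
    positivity
  · intro hy
    exact ⟨y ^ κ⁻¹, by positivity, Real.rpow_inv_rpow hy.le hκ.ne'⟩

theorem image_rpow_Ioo {κ : ℝ} (hκ : 0 < κ) {u : ℝ} (hu : 0 < u) :
    (fun x : ℝ => 1 * x ^ κ) '' Ioo 0 u = Ioo 0 (u ^ κ) := by
  ext y
  simp only [one_mul, mem_image, mem_Ioo]
  constructor
  · rintro ⟨x, hx, rfl⟩
    exact ⟨Real.rpow_pos_of_pos hx.1 _, Real.rpow_lt_rpow hx.1.le hx.2 hκ⟩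
  · rintro ⟨hy, hyu⟩
    refine ⟨y ^ κ⁻¹, ⟨by positivity, ?_⟩, Real.rpow_inv_rpow hy.le hκ.ne'⟩
    rw [← Real.rpow_rpow_inv hu.le hκ.ne']
    exact Real.rpow_lt_rpow hy.le hyu (by positivity)

/-- Change of variables `t = x ^ κ` in weighted norms. -/
theorem wnorm_dil {q : ℝ≥0∞} (hq : 0 < q) {κ : ℝ} (hκ : 0 < κ) (α : ℝ) (w : ℝ → ℝ)
    (F : ℝ → ℝ≥0∞) {I : Set ℝ} (hI : MeasurableSet I) (hI0 : I ⊆ Ioi 0)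
    (hI' : MeasurableSet ((fun x : ℝ => 1 * x ^ κ) '' I)) :
    wnorm q (α / κ) (dil κ w) F ((fun x : ℝ => 1 * x ^ κ) '' I) =
      ENNReal.ofReal κ ^ (q⁻¹).toReal * wnorm q α w (fun x => F (x ^ κ)) I := by
  rw [wnorm_eq_unit_weight q _ _ _ hI', wnorm_eq_unit_weight q α _ _ hI hI0,
    wnorm_image_const_mul_rpow hq one_pos hκ hI hI0]
  · congr 1
    refine wnorm_congr hI fun x hx => ?_
    have hx0 : 0 < x := hI0 hx
    simp only [dil, one_mul]
    rw [← Real.rpow_mul hx0.le, ← Real.rpow_mul hx0.le, mul_div_cancel₀ _ hκ.ne',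
      mul_one_div_cancel hκ.ne', Real.rpow_one]
  · rintro _ ⟨x, hx, rfl⟩
    have hx0 : 0 < x := hI0 hx
    simp only [mem_Ioi]
    positivity

theorem ofReal_rpow_eq_coe {κ : ℝ} (hκ : 0 < κ) (q : ℝ≥0∞) :
    ∃ k : ℝ≥0, k ≠ 0 ∧ ENNReal.ofReal κ ^ (q⁻¹).toReal = k := by
  refine ⟨(κ ^ (q⁻¹).toReal).toNNReal, ?_, ?_⟩
  · have : 0 < κ ^ (q⁻¹).toReal := by positivity
    simpa using this
  · rw [ENNReal.ofReal_rpow_of_pos hκ]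
    rfl

theorem wnorm_dil_Ioi {q : ℝ≥0∞} (hq : 0 < q) {κ : ℝ} (hκ : 0 < κ) :
    ∃ k : ℝ≥0, k ≠ 0 ∧ ∀ (α : ℝ) (w : ℝ → ℝ) (F : ℝ → ℝ≥0∞),
      wnorm q (α / κ) (dil κ w) F (Ioi 0) = k * wnorm q α w (fun x => F (x ^ κ)) (Ioi 0) := by
  obtain ⟨k, hk, hk'⟩ := ofReal_rpow_eq_coe hκ q
  refine ⟨k, hk, fun α w F => ?_⟩
  have := wnorm_dil hq hκ α w F measurableSet_Ioi subset_rfl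
    (by rw [image_rpow_Ioi hκ]; exact measurableSet_Ioi)
  rwa [image_rpow_Ioi hκ, hk'] at this

theorem wnorm_dil_Ioo {q : ℝ≥0∞} (hq : 0 < q) {κ : ℝ} (hκ : 0 < κ) :
    ∃ k : ℝ≥0, k ≠ 0 ∧ ∀ (α : ℝ) (w : ℝ → ℝ) (F : ℝ → ℝ≥0∞) (u : ℝ), 0 < u →
      wnorm q (α / κ) (dil κ w) F (Ioo 0 (u ^ κ)) =
        k * wnorm q α w (fun x => F (x ^ κ)) (Ioo 0 u) := by
  obtain ⟨k, hk, hk'⟩ := ofReal_rpow_eq_coe hκ q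
  refine ⟨k, hk, fun α w F u hu => ?_⟩
  have := wnorm_dil hq hκ α w F (I := Ioo 0 u) measurableSet_Ioo Ioo_subset_Ioi_self
    (by rw [image_rpow_Ioo hκ hu]; exact measurableSet_Ioo)
  rwa [image_rpow_Ioo hκ hu, hk'] at this

/-- Change of variables `t = x ^ κ` in the iterated norms. -/
theorem llNorm_dil {s r q : ℝ≥0∞} (hs : 0 < s) (hr : 0 < r) (hq : 0 < q) {κ : ℝ} (hκ : 0 < κ) :
    ∃ k : ℝ≥0, k ≠ 0 ∧ ∀ (α : ℝ) (c b a : ℝ → ℝ) (F : ℝ → ℝ≥0∞),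
      llNorm (α / κ) s (dil κ c) r (dil κ b) q (dil κ a) F =
        k * llNorm α s c r b q a (fun x => F (x ^ κ)) := by
  obtain ⟨k₁, h₁, e₁⟩ := wnorm_dil_Ioo hq hκ
  obtain ⟨k₂, h₂, e₂⟩ := wnorm_dil_Ioo hr hκ
  obtain ⟨k₃, h₃, e₃⟩ := wnorm_dil_Ioi hs hκ
  refine ⟨k₃ * (k₂ * k₁), by positivity, fun α c b a F => ?_⟩
  unfold llNorm
  have e₃' := e₃ 0 c
  have e₂' := e₂ 0 b
  rw [zero_div] at e₃' e₂'
  -- Substituting in the outermost variable first turns the next interval into (0, t^κ), the form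
  -- the next substitution needs.
  rw [e₃', ENNReal.coe_mul, mul_assoc]
  congr 1
  rw [← wnorm_const_mul measurableSet_Ioi (by positivity)]
  refine wnorm_congr measurableSet_Ioi fun t ht => ?_
  rw [e₂' _ _ ht, ENNReal.coe_mul, mul_assoc (k₂ : ℝ≥0∞),
    ← wnorm_const_mul measurableSet_Ioo h₁]
  congr 2
  exact wnorm_congr measurableSet_Ioo fun u hu => by rw [e₁ _ _ _ _ hu.1]

/-! ### Monotonicity and infinite values of the iterated norm -/

theorem llNorm_mono_inner {s r q : ℝ≥0∞} {α β : ℝ} {c b a a' : ℝ → ℝ} {F G : ℝ → ℝ≥0∞}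
    (C : ℝ≥0) (h : ∀ u, 0 < u → wnorm q α a F (Ioo 0 u) ≤ C * wnorm q β a' G (Ioo 0 u)) :
    llNorm α s c r b q a F ≤ C * llNorm β s c r b q a' G :=
  wnorm_mono measurableSet_Ioi C fun _ _ =>
    wnorm_mono measurableSet_Ioo C fun u hu => h u hu.1

theorem llNorm_mono {s r q : ℝ≥0∞} {α : ℝ} {c b a : ℝ → ℝ} {F G : ℝ → ℝ≥0∞}
    (C : ℝ≥0) (h : ∀ t, 0 < t → F t ≤ C * G t) :
    llNorm α s c r b q a F ≤ C * llNorm α s c r b q a G :=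
  llNorm_mono_inner C fun _ _ => wnorm_mono measurableSet_Ioo C fun t ht => h t ht.1

theorem wnorm_eq_top {q : ℝ≥0∞} (hq : 0 < q) {α : ℝ} {w : ℝ → ℝ} {F : ℝ → ℝ≥0∞} {I : Set ℝ}
    (hI : MeasurableSet I) (hI0 : I ⊆ Ioi 0) (hIv : volume I ≠ 0)
    (hw : ∀ t, 0 < t → 0 < w t) (hF : ∀ t ∈ I, F t = ∞) : wnorm q α w F I = ∞ := by
  unfold wnorm
  have : eLpNorm (fun t : ℝ => ENNReal.ofReal (t ^ (α - (q⁻¹).toReal) * w t) * F t) q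
      (volume.restrict I) = eLpNorm (fun _ : ℝ => (∞ : ℝ≥0∞)) q (volume.restrict I) := by
    refine eLpNorm_congr_ae ?_
    filter_upwards [ae_restrict_mem hI] with t ht
    have ht0 : 0 < t := hI0 ht
    have := hw t ht0
    rw [hF t ht, ENNReal.mul_top]
    simp only [ne_eq, ENNReal.ofReal_eq_zero, not_le]
    positivity
  rw [this]
  rcases eq_or_ne q ∞ with rfl | hq'
  · rw [eLpNorm_exponent_top, eLpNormEssSup_eq_essSup_enorm]
    simp only [enorm_eq_self]
    exact essSup_const _ (by simpa using hIv)
  · have hq0 : 0 < q.toReal := ENNReal.toReal_pos hq.ne' hq'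
    rw [eLpNorm_eq_lintegral_rpow_enorm_toReal hq.ne' hq']
    simp only [enorm_eq_self, ENNReal.top_rpow_of_pos hq0, lintegral_const,
      Measure.restrict_apply_univ, ENNReal.top_mul hIv]
    exact ENNReal.top_rpow_of_pos (by positivity)

/-- Outside A₀ + A₁ the K-functional is identically ∞; this lets finiteness of the quasi-norm alone
decide membership in the interpolation space. -/
theorem llNorm_eq_top {s r q : ℝ≥0∞} (hs : 0 < s) (hr : 0 < r) (hq : 0 < q) {α : ℝ}
    {c b a : ℝ → ℝ} (hc : SlowlyVarying c) (hb : SlowlyVarying b) (ha : SlowlyVarying a)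
    {F : ℝ → ℝ≥0∞} (hF : ∀ t, 0 < t → F t = ∞) : llNorm α s c r b q a F = ∞ := by
  have hvol : ∀ u : ℝ, 0 < u → volume (Ioo 0 u) ≠ 0 := fun u hu => by simpa using hu
  refine wnorm_eq_top hs measurableSet_Ioi subset_rfl (by simp) hc.pos fun t ht => ?_
  refine wnorm_eq_top hr measurableSet_Ioo Ioo_subset_Ioi_self (hvol t ht) hb.pos fun u hu => ?_
  exact wnorm_eq_top hq measurableSet_Ioo Ioo_subset_Ioi_self (hvol u hu.1) ha.pos
    fun v hv => hF v hv.1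

/-! ### Rearrangements and the K-functional of (L_κ, L_∞) -/

section Rearrangement

variable {Ω : Type*} [MeasurableSpace Ω] {𝕜 : Type*} [RCLike 𝕜] {μ : Measure Ω}

theorem rearrangement_antitone (f : Ω →ₘ[μ] 𝕜) : Antitone (rearrangement f) := fun _ _ h =>
  sInf_le_sInf fun _ hl => le_trans hl (ENNReal.ofReal_le_ofReal h)

theorem rearrangement_le {f : Ω →ₘ[μ] 𝕜} {t : ℝ} {l : ℝ≥0∞}
    (h : μ {x | l < ‖f x‖ₑ} ≤ ENNReal.ofReal t) : rearrangement f t ≤ l :=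
  sInf_le h

/-- The infimum defining f*(t) is attained: along levels decreasing to it, the superlevel sets
increase, and the measure is continuous from below. -/
theorem measure_rearrangement_lt_le (f : Ω →ₘ[μ] 𝕜) (t : ℝ) :
    μ {x | rearrangement f t < ‖f x‖ₑ} ≤ ENNReal.ofReal t := by
  set S : Set ℝ≥0∞ := {l : ℝ≥0∞ | μ {x | l < ‖f x‖ₑ} ≤ ENNReal.ofReal t} with hS
  have hne : S.Nonempty := ⟨∞, by simp [hS]⟩
  obtain ⟨l, hl, hlim, hmem⟩ := exists_seq_tendsto_sInf hne (OrderBot.bddBelow S)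
  have hset : {x | rearrangement f t < ‖f x‖ₑ} = ⋃ n, {x | l n < ‖f x‖ₑ} := by
    ext x
    simp only [mem_ofPred_eq, mem_iUnion]
    constructor
    · intro hx
      exact (hlim.eventually_lt_const hx).exists
    · rintro ⟨n, hn⟩
      exact (sInf_le (hmem n)).trans_lt hn
  have hmono : Monotone fun n => {x | l n < ‖f x‖ₑ} := fun m n hmn x hx =>
    (hl hmn).trans_lt hx
  rw [hset, hmono.measure_iUnion]
  exact iSup_le hmem

/-- Almost everywhere |g| ≤ ‖g‖_∞, so |f + g| > f*(t) + ‖g‖_∞ forces |f| > f*(t). -/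
theorem rearrangement_add_le (f g : Ω →ₘ[μ] 𝕜) (t : ℝ) :
    rearrangement (f + g) t ≤ rearrangement f t + eLpNorm g ∞ μ := by
  refine rearrangement_le ((measure_mono_ae ?_).trans (measure_rearrangement_lt_le f t))
  rw [eLpNorm_exponent_top]
  filter_upwards [AEEqFun.coeFn_add f g, enorm_ae_le_eLpNormEssSup g μ] with x hx hg hlt
  change _ < ‖(f + g) x‖ₑ at hlt
  rw [hx, Pi.add_apply] at hlt
  have h := hlt.trans_le ((enorm_add_le _ _).trans (add_le_add_right hg _))
  exact lt_of_add_lt_add_right h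

/-- Chebyshev's inequality at the level ‖f‖_κ / t^{1/κ}; the norms 0 and ∞ are treated apart, since
that factor is cancelled at the end. -/
theorem ofReal_rpow_mul_rearrangement_le_eLpNorm {κ : ℝ} (hκ : 0 < κ) (f : Ω →ₘ[μ] 𝕜) {t : ℝ}
    (ht : 0 < t) :
    ENNReal.ofReal (t ^ (1 / κ)) * rearrangement f t ≤ eLpNorm f (ENNReal.ofReal κ) μ := by
  set N := eLpNorm f (ENNReal.ofReal κ) μ with hN
  set T := ENNReal.ofReal (t ^ (1 / κ)) with hT
  have hT0 : T ≠ 0 := by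
    simp only [hT, ne_eq, ENNReal.ofReal_eq_zero, not_le]
    positivity
  have hTtop : T ≠ ∞ := ENNReal.ofReal_ne_top
  have hκ0 : ENNReal.ofReal κ ≠ 0 := by simpa using hκ
  rw [mul_comm, ← ENNReal.le_div_iff_mul_le (Or.inl hT0) (Or.inl hTtop)]
  rcases eq_or_ne N 0 with h0 | h0
  · refine rearrangement_le ?_
    rw [hN, eLpNorm_eq_zero_iff f.aestronglyMeasurable hκ0] at h0
    have : μ {x | N / T < ‖f x‖ₑ} = 0 := by
      refine measure_mono_null (fun x hx => ?_) h0
      intro hfx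
      change _ < ‖f x‖ₑ at hx
      rw [hfx] at hx
      simp at hx
    rw [this]
    exact zero_le
  rcases eq_or_ne N ∞ with htop | htop
  · rw [htop, ENNReal.top_div_of_ne_top hTtop]
    exact le_top
  refine rearrangement_le ((measure_mono (t := {x | N / T ≤ ‖f x‖ₑ})
    fun x (hx : N / T < ‖f x‖ₑ) => hx.le).trans ?_)
  have := mul_meas_ge_le_pow_eLpNorm' μ hκ0 ENNReal.ofReal_ne_top f.aestronglyMeasurable (N / T)
  rw [ENNReal.toReal_ofReal hκ.le, ← hN, ENNReal.div_rpow_of_nonneg _ _ hκ.le] at this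
  have hTκ : T ^ κ = ENNReal.ofReal t := by
    rw [hT, ENNReal.ofReal_rpow_of_pos (by positivity), ← Real.rpow_mul ht.le,
      one_div_mul_cancel hκ.ne', Real.rpow_one]
  have hNκ0 : N ^ κ ≠ 0 := by simp [ENNReal.rpow_eq_zero_iff, h0, htop]
  have hNκ : N ^ κ ≠ ∞ := ENNReal.rpow_ne_top_of_nonneg hκ.le htop
  have ht0 : ENNReal.ofReal t ≠ 0 := by simpa using ht
  rw [hTκ, ENNReal.div_eq_inv_mul, mul_comm, mul_comm _ (N ^ κ), ← mul_assoc,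
    ← ENNReal.div_eq_inv_mul.trans (mul_comm _ _),
    ENNReal.div_le_iff_le_mul (Or.inl ht0) (Or.inl ENNReal.ofReal_ne_top), mul_comm (N ^ κ)] at this
  exact (ENNReal.mul_le_mul_iff_left hNκ0 hNκ).1 this

/-- Bound for the part of `f` above the level `f^*(v^κ)`, by a dyadic decomposition. -/
theorem lintegral_rearrangement_lt_le {κ : ℝ} (hκ : 0 < κ) (f : Ω →ₘ[μ] 𝕜) {v : ℝ} (hv : 0 < v) :
    ∫⁻ x in {x | rearrangement f (v ^ κ) < ‖f x‖ₑ}, ‖f x‖ₑ ^ κ ∂μ ≤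
      ∑' j : ℕ, (2 * (ENNReal.ofReal ((1 / 2) ^ (j + 1) * v) *
        rearrangement f (((1 / 2) ^ (j + 1) * v) ^ κ))) ^ κ := by
  set L : ℕ → ℝ≥0∞ := fun j => rearrangement f (((1 / 2) ^ j * v) ^ κ) with hL
  have hnorm : Measurable fun x => ‖f x‖ₑ := f.measurable.enorm
  set N : Set Ω := {x | ∀ j, L j < ‖f x‖ₑ} with hN
  set E : ℕ → Set Ω := fun j => {x | L j < ‖f x‖ₑ ∧ ‖f x‖ₑ ≤ L (j + 1)} with hE
  have hEm : ∀ j, MeasurableSet (E j) := fun j =>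
    (measurableSet_lt measurable_const hnorm).inter (measurableSet_le hnorm measurable_const)
  -- On `N` every level is exceeded, so μ N ≤ (2^{-j}v)^κ for all j.
  have hμN : μ N = 0 := by
    have hle : ∀ j, μ N ≤ ENNReal.ofReal (((1 / 2) ^ j * v) ^ κ) := fun j =>
      (measure_mono fun x (hx : ∀ j, L j < ‖f x‖ₑ) => hx j).trans (measure_rearrangement_lt_le f _)
    have hlim : Filter.Tendsto (fun j : ℕ => ENNReal.ofReal ((((1 : ℝ) / 2) ^ j * v) ^ κ))
        Filter.atTop (nhds 0) := by
      have h1 : Filter.Tendsto (fun j : ℕ => ((1 : ℝ) / 2) ^ j * v) Filter.atTop (nhds (0 * v)) :=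
        (tendsto_pow_atTop_nhds_zero_of_lt_one (by norm_num) (by norm_num)).mul_const v
      have h2 := ENNReal.tendsto_ofReal (h1.rpow_const (p := κ) (Or.inr hκ.le))
      simpa [Real.zero_rpow hκ.ne'] using h2
    exact le_antisymm (ge_of_tendsto' hlim hle) zero_le
  have hcover : {x | rearrangement f (v ^ κ) < ‖f x‖ₑ} ⊆ (⋃ j, E j) ∪ N := by
    intro x hx
    by_cases h : ∃ j, ‖f x‖ₑ ≤ L j
    · left
      classical
      have hspec := Nat.find_spec h
      have hpos : Nat.find h ≠ 0 := by
        intro h0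
        rw [h0] at hspec
        simp only [hL, pow_zero, one_mul] at hspec
        exact absurd hx (not_lt.2 hspec)
      obtain ⟨m, hm⟩ := Nat.exists_eq_succ_of_ne_zero hpos
      rw [hm] at hspec
      refine mem_iUnion.2 ⟨m, not_le.1 (Nat.find_min h ?_), hspec⟩
      rw [hm]
      exact Nat.lt_succ_self m
    · right
      push Not at h
      exact h
  calc ∫⁻ x in {x | rearrangement f (v ^ κ) < ‖f x‖ₑ}, ‖f x‖ₑ ^ κ ∂μ
      ≤ ∫⁻ x in (⋃ j, E j) ∪ N, ‖f x‖ₑ ^ κ ∂μ := lintegral_mono_set hcover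
    _ ≤ ∫⁻ x in ⋃ j, E j, ‖f x‖ₑ ^ κ ∂μ + ∫⁻ x in N, ‖f x‖ₑ ^ κ ∂μ := lintegral_union_le _ _ _
    _ = ∫⁻ x in ⋃ j, E j, ‖f x‖ₑ ^ κ ∂μ := by rw [setLIntegral_measure_zero _ _ hμN, add_zero]
    _ ≤ ∑' j, ∫⁻ x in E j, ‖f x‖ₑ ^ κ ∂μ := lintegral_iUnion_le _ _
    _ ≤ _ := by
      refine ENNReal.tsum_le_tsum fun j => ?_
      calc ∫⁻ x in E j, ‖f x‖ₑ ^ κ ∂μ ≤ ∫⁻ _ in E j, L (j + 1) ^ κ ∂μ :=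
            setLIntegral_mono' (hEm j) fun x hx => ENNReal.rpow_le_rpow hx.2 hκ.le
        _ = L (j + 1) ^ κ * μ (E j) := by simp
        _ ≤ L (j + 1) ^ κ * ENNReal.ofReal (((1 / 2) ^ j * v) ^ κ) := by
            gcongr
            exact (measure_mono fun x hx => hx.1).trans (measure_rearrangement_lt_le f _)
        _ = _ := by
            -- The slice has measure at most (2^{-j}v)^κ but height `L (j + 1)`; matching the
            -- indices by 2^{-j}v = 2 · 2^{-(j+1)}v produces the factor 2.
            rw [← ENNReal.ofReal_rpow_of_pos (by positivity),
              ← ENNReal.mul_rpow_of_nonneg _ _ hκ.le, ← mul_assoc 2, mul_comm (L (j + 1))]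
            congr 2
            rw [show (2 : ℝ≥0∞) = ENNReal.ofReal 2 by simp, ← ENNReal.ofReal_mul (by norm_num)]
            congr 1
            ring

/-- Upper bound for `K(v, f; L_κ, L_∞)` in terms of the dyadic values `f^*((2^{-j} v)^κ)`. -/
theorem kFunctional_lebesgue_le {κ : ℝ} (hκ : 0 < κ) {ρ : ℝ} (hρ0 : 0 < ρ) (hρ1 : ρ < 1) :
    ∃ C : ℝ≥0, ∀ (f : Ω →ₘ[μ] 𝕜) (v : ℝ) (M : ℝ≥0∞), 0 < v →
      (∀ j : ℕ, ENNReal.ofReal ((1 / 2) ^ j * v) * rearrangement f (((1 / 2) ^ j * v) ^ κ) ≤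
        ENNReal.ofReal (ρ ^ j) * M) →
      kFunctional (lebesgueSpace 𝕜 μ (ENNReal.ofReal κ)) (lebesgueSpace 𝕜 μ ∞) v f ≤ C * M := by
  have hκ0 : ENNReal.ofReal κ ≠ 0 := by simpa using hκ
  set B : ℝ≥0∞ := ∑' j : ℕ, (2 * ENNReal.ofReal (ρ ^ (j + 1))) ^ κ with hB
  have hBtop : B ≠ ∞ := by
    have hterm : ∀ j : ℕ, (2 * ENNReal.ofReal (ρ ^ (j + 1))) ^ κ =
        ENNReal.ofReal ((2 * ρ) ^ κ * (ρ ^ κ) ^ j) := by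
      intro j
      rw [show (2 : ℝ≥0∞) = ENNReal.ofReal 2 by simp, ← ENNReal.ofReal_mul (by norm_num),
        ENNReal.ofReal_rpow_of_pos (by positivity), pow_succ', ← mul_assoc,
        Real.mul_rpow (by positivity) (by positivity), ← Real.rpow_natCast, ← Real.rpow_mul hρ0.le,
        mul_comm (j : ℝ), Real.rpow_mul hρ0.le, Real.rpow_natCast]
    have hs : Summable fun j : ℕ => (2 * ρ) ^ κ * (ρ ^ κ) ^ j :=
      (summable_geometric_of_lt_one (by positivity)
        (Real.rpow_lt_one hρ0.le hρ1 hκ)).mul_left _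
    rw [hB]
    simp_rw [hterm]
    exact hs.tsum_ofReal_ne_top
  have hBκ : B ^ (1 / κ) ≠ ∞ := ENNReal.rpow_ne_top_of_nonneg (by positivity) hBtop
  -- B^{1/κ} pays for the part of f above the truncation level, 1 for the bounded part. The 1 also
  -- keeps the constant nonzero, which settles M = ∞.
  refine ⟨(B ^ (1 / κ)).toNNReal + 1, fun f v M hv h => ?_⟩
  rw [ENNReal.coe_add, ENNReal.coe_toNNReal hBκ, ENNReal.coe_one]
  rcases eq_or_ne M ∞ with rfl | hM
  · rw [ENNReal.mul_top (by simp)]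
    exact le_top
  have hnorm : Measurable fun x => ‖f x‖ₑ := f.measurable.enorm
  set L := rearrangement f (v ^ κ) with hL
  set A : Set Ω := {x | L < ‖f x‖ₑ} with hA
  have hAm : MeasurableSet A := measurableSet_lt measurable_const hnorm
  have hm0 : AEStronglyMeasurable (A.indicator f) μ := f.aestronglyMeasurable.indicator hAm
  have hm1 : AEStronglyMeasurable (Aᶜ.indicator f) μ := f.aestronglyMeasurable.indicator hAm.compl
  -- The index j = 0 controls the bounded part; the upper part uses only j ≥ 1.
  have hv0 : ENNReal.ofReal v * L ≤ M := by simpa using h 0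
  have hv' : ENNReal.ofReal v ≠ 0 := by simpa using hv
  have hsum : f = AEEqFun.mk _ hm0 + AEEqFun.mk _ hm1 := by
    rw [AEEqFun.mk_add_mk]
    conv_lhs => rw [← AEEqFun.mk_coeFn f]
    congr 1
    exact (indicator_self_add_compl A f).symm
  have hn0 : eLpNorm (AEEqFun.mk _ hm0) (ENNReal.ofReal κ) μ ≤ B ^ (1 / κ) * M := by
    rw [eLpNorm_congr_ae (AEEqFun.coeFn_mk _ hm0), eLpNorm_indicator_eq_eLpNorm_restrict hAm,
      eLpNorm_eq_lintegral_rpow_enorm_toReal hκ0 ENNReal.ofReal_ne_top, ENNReal.toReal_ofReal hκ.le]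
    have hMκ : M = (M ^ κ) ^ (1 / κ) := by
      rw [← ENNReal.rpow_mul, mul_one_div_cancel hκ.ne', ENNReal.rpow_one]
    rw [hMκ, ← ENNReal.mul_rpow_of_nonneg _ _ (by positivity)]
    refine ENNReal.rpow_le_rpow ((lintegral_rearrangement_lt_le hκ f hv).trans ?_) (by positivity)
    rw [hB, ← ENNReal.tsum_mul_right]
    refine ENNReal.tsum_le_tsum fun j => ?_
    rw [← ENNReal.mul_rpow_of_nonneg _ _ hκ.le, mul_assoc]
    exact ENNReal.rpow_le_rpow (mul_le_mul_right (h (j + 1)) _) hκ.le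
  have hn1 : eLpNorm (AEEqFun.mk _ hm1) ∞ μ ≤ L := by
    rw [eLpNorm_congr_ae (AEEqFun.coeFn_mk _ hm1), eLpNorm_exponent_top,
      eLpNormEssSup_eq_essSup_enorm]
    refine essSup_le_of_ae_le _ (Filter.Eventually.of_forall fun x => ?_)
    by_cases hx : x ∈ A
    · simp [hx]
    · simpa [hx] using not_lt.1 hx
  have hLtop : L < ∞ := by
    refine lt_of_not_ge fun hge => hM ?_
    rw [top_le_iff.1 hge, ENNReal.mul_top hv'] at hv0
    exact top_le_iff.1 hv0
  have hc0 : AEEqFun.mk _ hm0 ∈ (lebesgueSpace 𝕜 μ (ENNReal.ofReal κ)).carrier :=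
    hn0.trans_lt (ENNReal.mul_lt_top hBκ.lt_top hM.lt_top)
  have hc1 : AEEqFun.mk _ hm1 ∈ (lebesgueSpace 𝕜 μ ∞).carrier := hn1.trans_lt hLtop
  calc kFunctional (lebesgueSpace 𝕜 μ (ENNReal.ofReal κ)) (lebesgueSpace 𝕜 μ ∞) v f
      ≤ eLpNorm (AEEqFun.mk _ hm0) (ENNReal.ofReal κ) μ +
        ENNReal.ofReal v * eLpNorm (AEEqFun.mk _ hm1) ∞ μ :=
        iInf_le_of_le _ <| iInf_le_of_le hc0 <| iInf_le_of_le _ <| iInf_le_of_le hc1 <|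
          iInf_le_of_le hsum le_rfl
    _ ≤ B ^ (1 / κ) * M + M :=
        add_le_add hn0 ((mul_le_mul_right hn1 _).trans hv0)
    _ = _ := by ring

end Rearrangement

/-! ### Dyadic dilations and slowly varying weights -/

/-- By invariance of dv/v under dilation, the left side is the norm of `H` on (0, lu), a subinterval
of (0, u). -/
theorem wnorm_dilation_le {q : ℝ≥0∞} (hq : 0 < q) {l : ℝ} (hl : 0 < l) (hl1 : l ≤ 1) {u : ℝ}
    (hu : 0 < u) (H : ℝ → ℝ≥0∞) :
    wnorm q 0 (fun _ => 1) (fun v => H (l * v)) (Ioo 0 u) ≤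
      wnorm q 0 (fun _ => 1) H (Ioo 0 u) := by
  have h := wnorm_image_const_mul_rpow hq hl one_pos (I := Ioo 0 u) measurableSet_Ioo
    Ioo_subset_Ioi_self H
  rw [image_const_mul_Ioo hl, ENNReal.ofReal_one, ENNReal.one_rpow, one_mul] at h
  simp only [Real.rpow_one] at h
  rw [← h]
  exact eLpNorm_mono_measure _
    (Measure.restrict_mono (Ioo_subset_Ioo_right (mul_le_of_le_one_left hu.le hl1)) le_rfl)

theorem aemeasurable_comp_const_mul {H : ℝ → ℝ≥0∞}
    (hH : AEMeasurable H (volume.restrict (Ioi 0))) {l : ℝ} (hl : 0 < l) :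
    AEMeasurable (fun v => H (l * v)) (volume.restrict (Ioi 0)) := by
  -- Extending by zero to the whole line makes the half-line compatible with dilation, which
  -- preserves null sets.
  rw [← aemeasurable_indicator_iff measurableSet_Ioi] at hH ⊢
  have hac : Measure.map (l * ·) (volume : Measure ℝ) ≪ volume := by
    rw [Real.map_volume_mul_left hl.ne']
    exact Measure.smul_absolutelyContinuous
  convert (hH.mono_ac hac).comp_measurable (measurable_const_mul l) using 1
  ext v
  simp only [indicator, mem_Ioi, Function.comp, mul_pos_iff_of_pos_left hl]

/-- A geometrically weighted supremum of dyadic dilations is bounded in the scale-invariant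
norms. -/
theorem wnorm_iSup_dyadic_le {q : ℝ≥0∞} (hq : 0 < q) {ρ : ℝ} (hρ0 : 0 < ρ) (hρ1 : ρ < 1) :
    ∃ C : ℝ≥0, ∀ H : ℝ → ℝ≥0∞, AEMeasurable H (volume.restrict (Ioi 0)) → ∀ u : ℝ, 0 < u →
      wnorm q 0 (fun _ => 1) (fun v => ⨆ j : ℕ, ENNReal.ofReal (ρ ^ j) * H ((1 / 2) ^ j * v))
        (Ioo 0 u) ≤ C * wnorm q 0 (fun _ => 1) H (Ioo 0 u) := by
  have hdil : ∀ (H : ℝ → ℝ≥0∞) (u : ℝ), 0 < u → ∀ j : ℕ,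
      wnorm q 0 (fun _ => 1) (fun v => H ((1 / 2) ^ j * v)) (Ioo 0 u) ≤
        wnorm q 0 (fun _ => 1) H (Ioo 0 u) := fun H u hu j =>
    wnorm_dilation_le hq (by positivity) (pow_le_one₀ (by norm_num) (by norm_num)) hu H
  rcases eq_or_ne q ∞ with rfl | hq'
  · refine ⟨1, fun H _ u hu => ?_⟩
    rw [ENNReal.coe_one, one_mul]
    have hd := hdil H u hu
    unfold wnorm at hd ⊢
    simp only [ENNReal.inv_top, ENNReal.toReal_zero, sub_zero, Real.rpow_zero, mul_one,
      ENNReal.ofReal_one, one_mul, eLpNorm_exponent_top, eLpNormEssSup_eq_essSup_enorm,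
      enorm_eq_self] at hd ⊢
    have hae : ∀ᵐ v ∂(volume.restrict (Ioo 0 u)), ∀ j : ℕ,
        H ((1 / 2) ^ j * v) ≤ essSup H (volume.restrict (Ioo 0 u)) := by
      rw [ae_all_iff]
      intro j
      filter_upwards [ae_le_essSup (f := fun v => H ((1 / 2) ^ j * v))
        (μ := volume.restrict (Ioo 0 u))] with v hv using hv.trans (hd j)
    refine essSup_le_of_ae_le _ ?_
    filter_upwards [hae] with v hv
    refine iSup_le fun j => ?_
    calc _ ≤ 1 * H ((1 / 2) ^ j * v) := by
          gcongr
          rw [← ENNReal.ofReal_one]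
          exact ENNReal.ofReal_le_ofReal (pow_le_one₀ hρ0.le hρ1.le)
      _ ≤ _ := by rw [one_mul]; exact hv j
  have hq0 : 0 < q.toReal := ENNReal.toReal_pos hq.ne' hq'
  set B : ℝ≥0∞ := ∑' j : ℕ, ENNReal.ofReal (ρ ^ j) ^ q.toReal with hB
  have hBtop : B ≠ ∞ := by
    have hterm : ∀ j : ℕ, ENNReal.ofReal (ρ ^ j) ^ q.toReal =
        ENNReal.ofReal ((ρ ^ q.toReal) ^ j) := by
      intro j
      rw [ENNReal.ofReal_rpow_of_pos (by positivity), ← Real.rpow_natCast, ← Real.rpow_mul hρ0.le,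
        mul_comm (j : ℝ), Real.rpow_mul hρ0.le, Real.rpow_natCast]
    rw [hB]
    simp_rw [hterm]
    exact (summable_geometric_of_lt_one (by positivity)
      (Real.rpow_lt_one hρ0.le hρ1 hq0)).tsum_ofReal_ne_top
  have hBq : B ^ (1 / q.toReal) ≠ ∞ := ENNReal.rpow_ne_top_of_nonneg (by positivity) hBtop
  refine ⟨(B ^ (1 / q.toReal)).toNNReal, fun H hH u hu => ?_⟩
  rw [ENNReal.coe_toNNReal hBq]
  have hd := hdil H u hu
  set N := wnorm q 0 (fun _ => 1) H (Ioo 0 u) with hN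
  set W : ℝ → ℝ≥0∞ := fun t => ENNReal.ofReal (t ^ (0 - (q⁻¹).toReal) * 1) with hW
  have hWm : Measurable W := by fun_prop
  unfold wnorm at hd ⊢
  simp only [eLpNorm_eq_lintegral_rpow_enorm_toReal hq.ne' hq', enorm_eq_self] at hd ⊢
  have hNq : N = (N ^ q.toReal) ^ (1 / q.toReal) := by
    rw [← ENNReal.rpow_mul, mul_one_div_cancel hq0.ne', ENNReal.rpow_one]
  rw [hNq, ← ENNReal.mul_rpow_of_nonneg _ _ (by positivity)]
  refine ENNReal.rpow_le_rpow ?_ (by positivity)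
  have hmeas : ∀ j : ℕ, AEMeasurable (fun t => (W t * H ((1 / 2) ^ j * t)) ^ q.toReal)
      (volume.restrict (Ioo 0 u)) := fun j =>
    ((hWm.aemeasurable.mul ((aemeasurable_comp_const_mul hH (by positivity)).mono_measure
      (Measure.restrict_mono Ioo_subset_Ioi_self le_rfl))).pow_const _)
  calc ∫⁻ t in Ioo 0 u,
        (W t * ⨆ j : ℕ, ENNReal.ofReal (ρ ^ j) * H ((1 / 2) ^ j * t)) ^ q.toReal
      ≤ ∫⁻ t in Ioo 0 u, ∑' j : ℕ,
          ENNReal.ofReal (ρ ^ j) ^ q.toReal * (W t * H ((1 / 2) ^ j * t)) ^ q.toReal := by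
        -- The q-th power of a supremum is at most the sum of the q-th powers; no triangle
        -- inequality enters, so q < 1 is allowed.
        refine lintegral_mono fun t => ?_
        rw [← ENNReal.le_rpow_inv_iff hq0, ENNReal.mul_iSup]
        refine iSup_le fun j => ?_
        rw [ENNReal.le_rpow_inv_iff hq0]
        refine le_trans (le_of_eq ?_) (ENNReal.le_tsum j)
        rw [← ENNReal.mul_rpow_of_nonneg _ _ hq0.le]
        congr 1
        ring
    _ = ∑' j : ℕ, ENNReal.ofReal (ρ ^ j) ^ q.toReal *
          ∫⁻ t in Ioo 0 u, (W t * H ((1 / 2) ^ j * t)) ^ q.toReal := by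
        rw [lintegral_tsum fun j => (hmeas j).const_mul _]
        congr 1
        ext j
        exact lintegral_const_mul'' _ (hmeas j)
    _ ≤ ∑' j : ℕ, ENNReal.ofReal (ρ ^ j) ^ q.toReal * N ^ q.toReal := by
        refine ENNReal.tsum_le_tsum fun j => mul_le_mul_right ?_ _
        have := hd j
        rwa [one_div q.toReal, ENNReal.rpow_inv_le_iff hq0] at this
    _ = B * N ^ q.toReal := ENNReal.tsum_mul_right

/-- Decay of `v ^ (-θ) * a v` along dyadic dilations, for slowly varying `a`. -/
theorem SlowlyVarying.rpow_neg_mul_le {a : ℝ → ℝ} (ha : SlowlyVarying a) {θ : ℝ} (hθ : 0 < θ) :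
    ∃ D : ℝ, 0 < D ∧ ∀ v, 0 < v → ∀ j : ℕ, v ^ (-θ) * a v ≤
      D * (((1 / 2) ^ (θ / 3)) ^ j * ((1 / 2) ^ (θ / 3)) ^ j *
        (((1 / 2) ^ j * v) ^ (-θ) * a ((1 / 2) ^ j * v))) := by
  -- One third of the exponent θ is spent on absorbing `a`; the other two thirds yield two factors
  -- 2^{-jθ/3}.
  obtain ⟨g, C, hg, hC, h⟩ := ha.equiv_anti (θ / 3) (by positivity)
  refine ⟨C * C, by positivity, fun v hv j => ?_⟩
  set w := (1 / 2) ^ j * v with hw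
  have hw0 : 0 < w := by positivity
  have hwv : w ≤ v := mul_le_of_le_one_left hv.le (pow_le_one₀ (by norm_num) (by norm_num))
  have haw := ha.pos w hw0
  have h1 : v ^ (-(θ / 3)) * a v ≤ C * (C * (w ^ (-(θ / 3)) * a w)) :=
    (h v hv).1.trans (mul_le_mul_of_nonneg_left ((hg hw0 hv hwv).trans (h w hw0).2) hC.le)
  have hsplit : ∀ x : ℝ, 0 < x → x ^ (-θ) = x ^ (-(2 * θ / 3)) * x ^ (-(θ / 3)) := by
    intro x hx
    rw [← Real.rpow_add hx]
    congr 1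
    ring
  have hvw : v ^ (-(2 * θ / 3)) =
      ((1 / 2) ^ (θ / 3)) ^ j * ((1 / 2) ^ (θ / 3)) ^ j * w ^ (-(2 * θ / 3)) := by
    have hhalf : (((1 : ℝ) / 2) ^ (θ / 3)) ^ j * ((1 / 2) ^ (θ / 3)) ^ j =
        (((1 : ℝ) / 2) ^ j) ^ (2 * θ / 3) := by
      rw [← Real.rpow_natCast, ← Real.rpow_natCast, ← Real.rpow_mul (by norm_num),
        ← Real.rpow_mul (by norm_num), ← Real.rpow_add (by norm_num)]
      congr 1
      ring
    rw [hhalf, hw, Real.mul_rpow (by positivity) hv.le, ← mul_assoc,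
      ← Real.rpow_add (by positivity), add_neg_cancel, Real.rpow_zero, one_mul]
  calc v ^ (-θ) * a v = v ^ (-(2 * θ / 3)) * (v ^ (-(θ / 3)) * a v) := by
        rw [hsplit v hv, mul_assoc]
    _ ≤ v ^ (-(2 * θ / 3)) * (C * (C * (w ^ (-(θ / 3)) * a w))) := by gcongr
    _ = _ := by rw [hvw, hsplit w hw0]; ring

/-! ### Comparison of K-functionals with the rearrangement -/

section

variable {Ω : Type*} [MeasurableSpace Ω] (𝕜 : Type*) [RCLike 𝕜] (μ : Measure Ω)

/-- The only place where θ > 0 and the slow variation of `a` produce decay; it gives the embedding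
of the Lorentz–Karamata space into the strong interpolation space. -/
theorem wnorm_kFunctional_lebesgue_le {κ θ : ℝ} (hκ : 0 < κ) (hθ : 0 < θ) {q : ℝ≥0∞}
    (hq : 0 < q) {a : ℝ → ℝ} (ha : SlowlyVarying a) :
    ∃ C : ℝ≥0, ∀ (f : Ω →ₘ[μ] 𝕜) (u : ℝ), 0 < u →
      wnorm q (-θ) a (fun v => kFunctional (lebesgueSpace 𝕜 μ (ENNReal.ofReal κ))
        (lebesgueSpace 𝕜 μ ∞) v f) (Ioo 0 u) ≤
      C * wnorm q (-θ) a (fun v => ENNReal.ofReal v * rearrangement f (v ^ κ)) (Ioo 0 u) := by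
  set ρ : ℝ := (1 / 2) ^ (θ / 3) with hρ
  have hρ0 : 0 < ρ := by positivity
  have hρ1 : ρ < 1 := Real.rpow_lt_one (by norm_num) (by norm_num) (by positivity)
  obtain ⟨C₁, h₁⟩ := kFunctional_lebesgue_le (𝕜 := 𝕜) (μ := μ) hκ hρ0 hρ1
  obtain ⟨D, hD, h₂⟩ := ha.rpow_neg_mul_le hθ
  obtain ⟨C₃, h₃⟩ := wnorm_iSup_dyadic_le hq hρ0 hρ1
  refine ⟨C₁ * D.toNNReal * C₃, fun f u hu => ?_⟩
  set X : ℝ → ℝ≥0∞ := fun v => ENNReal.ofReal v * rearrangement f (v ^ κ) with hX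
  set H : ℝ → ℝ≥0∞ := fun v => ENNReal.ofReal (v ^ (-θ) * a v) * X v with hH
  have hHm : AEMeasurable H (volume.restrict (Ioi 0)) := by
    have hr : Measurable (rearrangement f) := (rearrangement_antitone f).measurable
    have h2 : Measurable X :=
      ENNReal.measurable_ofReal.mul (hr.comp (measurable_id.pow_const κ))
    exact ((measurable_id.pow_const (-θ)).aemeasurable.mul ha.measurable).ennreal_ofReal.mul
      h2.aemeasurable
  rw [wnorm_eq_unit_weight q (-θ) a _ measurableSet_Ioo Ioo_subset_Ioi_self,
    wnorm_eq_unit_weight q (-θ) a X measurableSet_Ioo Ioo_subset_Ioi_self]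
  rw [ENNReal.coe_mul, mul_assoc]
  refine le_trans (wnorm_mono measurableSet_Ioo (C₁ * D.toNNReal) fun v hv => ?_)
    (mul_le_mul_right (h₃ H hHm u hu) _)
  have hv0 : 0 < v := hv.1
  -- The least `M` for which the dyadic hypothesis of `kFunctional_lebesgue_le` holds at v.
  set M : ℝ≥0∞ := ⨆ j : ℕ, (ENNReal.ofReal (ρ ^ j))⁻¹ * X ((1 / 2) ^ j * v) with hM
  have hne : ∀ j : ℕ, ENNReal.ofReal (ρ ^ j) ≠ 0 := fun j => by
    simp only [ne_eq, ENNReal.ofReal_eq_zero, not_le]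
    positivity
  have hK := h₁ f v M hv0 fun j => by
    calc X ((1 / 2) ^ j * v) =
          ENNReal.ofReal (ρ ^ j) * ((ENNReal.ofReal (ρ ^ j))⁻¹ * X ((1 / 2) ^ j * v)) := by
          rw [← mul_assoc, ENNReal.mul_inv_cancel (hne j) ENNReal.ofReal_ne_top, one_mul]
      _ ≤ _ := mul_le_mul_right (le_iSup (fun j : ℕ =>
          (ENNReal.ofReal (ρ ^ j))⁻¹ * X ((1 / 2) ^ j * v)) j) _
  have hsup : ENNReal.ofReal (v ^ (-θ) * a v) * M ≤ D.toNNReal *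
      ⨆ j : ℕ, ENNReal.ofReal (ρ ^ j) * H ((1 / 2) ^ j * v) := by
    rw [hM, ENNReal.mul_iSup, ENNReal.mul_iSup]
    refine iSup_mono fun j => ?_
    calc ENNReal.ofReal (v ^ (-θ) * a v) * ((ENNReal.ofReal (ρ ^ j))⁻¹ * X ((1 / 2) ^ j * v))
        ≤ ENNReal.ofReal (D * (ρ ^ j * ρ ^ j *
            (((1 / 2) ^ j * v) ^ (-θ) * a ((1 / 2) ^ j * v)))) *
            ((ENNReal.ofReal (ρ ^ j))⁻¹ * X ((1 / 2) ^ j * v)) := by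
          exact mul_le_mul_left (ENNReal.ofReal_le_ofReal (h₂ v hv0 j)) _
      _ = ENNReal.ofReal D * (ENNReal.ofReal (ρ ^ j) *
            (ENNReal.ofReal (((1 / 2) ^ j * v) ^ (-θ) * a ((1 / 2) ^ j * v)) *
              X ((1 / 2) ^ j * v))) * (ENNReal.ofReal (ρ ^ j) * (ENNReal.ofReal (ρ ^ j))⁻¹) := by
          rw [ENNReal.ofReal_mul hD.le, ENNReal.ofReal_mul (by positivity),
            ENNReal.ofReal_mul (by positivity)]
          ring
      _ = _ := by
          rw [ENNReal.mul_inv_cancel (hne j) ENNReal.ofReal_ne_top, mul_one]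
          rfl
  calc _ ≤ ENNReal.ofReal (v ^ (-θ) * a v) * (C₁ * M) := mul_le_mul_right hK _
    _ = C₁ * (ENNReal.ofReal (v ^ (-θ) * a v) * M) := by ring
    _ ≤ C₁ * (D.toNNReal * ⨆ j : ℕ, ENNReal.ofReal (ρ ^ j) * H ((1 / 2) ^ j * v)) :=
        mul_le_mul_right hsup _
    _ = _ := by rw [ENNReal.coe_mul, mul_assoc]

/-- The essential supremum bounds the weighted rearrangement only almost everywhere. Monotonicity of
f* gives x^{1/κ} f*(t) ≤ x^{1/κ} f*(x) for x < t, and letting x increase to t recovers the bound at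
every t. -/
theorem ofReal_rpow_mul_rearrangement_le_lorentz {κ : ℝ} (hκ : 0 < κ) (f : Ω →ₘ[μ] 𝕜) {t : ℝ}
    (ht : 0 < t) :
    ENNReal.ofReal (t ^ (1 / κ)) * rearrangement f t ≤
      (lorentzSpace 𝕜 μ (ENNReal.ofReal κ) ∞).qnorm f := by
  have hexp : ((ENNReal.ofReal κ)⁻¹).toReal = 1 / κ := by
    rw [ENNReal.toReal_inv, ENNReal.toReal_ofReal hκ.le, one_div]
  simp only [lorentzSpace, wnorm, hexp, ENNReal.inv_top, ENNReal.toReal_zero, sub_zero, mul_one,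
    eLpNorm_exponent_top, eLpNormEssSup_eq_essSup_enorm, enorm_eq_self]
  set N := essSup (fun t => ENNReal.ofReal (t ^ (1 / κ)) * rearrangement f t)
    (volume.restrict (Ioi 0)) with hN
  have hae : ∀ᵐ x ∂(volume.restrict (Ioo 0 t)),
      ENNReal.ofReal (x ^ (1 / κ)) * rearrangement f t ≤ N := by
    filter_upwards [ae_restrict_mem measurableSet_Ioo,
      ae_mono (Measure.restrict_mono (Ioo_subset_Ioi_self : Ioo 0 t ⊆ Ioi 0) le_rfl)
        (ae_le_essSup (f := fun t => ENNReal.ofReal (t ^ (1 / κ)) * rearrangement f t)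
          (μ := volume.restrict (Ioi 0)))] with x hx hxN
    exact (mul_le_mul_right (rearrangement_antitone f hx.2.le) _).trans hxN
  have hall : ∀ y ∈ Ioo 0 t, ENNReal.ofReal (y ^ (1 / κ)) * rearrangement f t ≤ N := by
    intro y hy
    -- Positive measure of (y, t) supplies a point x > y at which the almost-everywhere bound holds.
    have hpos : volume.restrict (Ioo 0 t) (Ioo y t) ≠ 0 := by
      rw [Measure.restrict_apply measurableSet_Ioo,
        inter_eq_left.2 (Ioo_subset_Ioo_left hy.1.le)]
      simpa using hy.2
    obtain ⟨x, hx, hxN⟩ := (frequently_ae_mem_iff.2 hpos).and_eventually hae |>.exists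
    refine le_trans ?_ hxN
    gcongr
    · exact hy.1.le
    · exact hx.1.le
  have hlim : Filter.Tendsto (fun y : ℝ => ENNReal.ofReal (y ^ (1 / κ)) * rearrangement f t)
      (nhdsWithin t (Iio t)) (nhds (ENNReal.ofReal (t ^ (1 / κ)) * rearrangement f t)) := by
    refine ENNReal.Tendsto.mul_const (ENNReal.tendsto_ofReal ?_) (Or.inl ?_)
    · exact (Real.continuousAt_rpow_const t (1 / κ) (Or.inl ht.ne')).continuousWithinAt
    · simp only [ne_eq, ENNReal.ofReal_eq_zero, not_le]
      positivity
  refine le_of_tendsto hlim ?_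
  filter_upwards [Ioo_mem_nhdsLT ht] with y hy using hall y hy

theorem lorentz_qnorm_le_lebesgue {κ : ℝ} (hκ : 0 < κ) (f : Ω →ₘ[μ] 𝕜) :
    (lorentzSpace 𝕜 μ (ENNReal.ofReal κ) ∞).qnorm f ≤
      (lebesgueSpace 𝕜 μ (ENNReal.ofReal κ)).qnorm f := by
  have hexp : ((ENNReal.ofReal κ)⁻¹).toReal = 1 / κ := by
    rw [ENNReal.toReal_inv, ENNReal.toReal_ofReal hκ.le, one_div]
  simp only [lorentzSpace, lebesgueSpace, wnorm, hexp, ENNReal.inv_top, ENNReal.toReal_zero,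
    sub_zero, mul_one, eLpNorm_exponent_top, eLpNormEssSup_eq_essSup_enorm, enorm_eq_self]
  refine essSup_le_of_ae_le _ ?_
  filter_upwards [ae_restrict_mem measurableSet_Ioi] with t ht using
    ofReal_rpow_mul_rearrangement_le_eLpNorm hκ f ht

/-- For any splitting, f*(v^κ) ≤ f₀*(v^κ) + ‖f₁‖_∞; the weak bound for f₀ at t = v^κ carries exactly
the factor t^{1/κ} = v. -/
theorem ofReal_mul_rearrangement_le_kFunctional {κ : ℝ} (hκ : 0 < κ) (f : Ω →ₘ[μ] 𝕜) {v : ℝ}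
    (hv : 0 < v) :
    ENNReal.ofReal v * rearrangement f (v ^ κ) ≤
      kFunctional (lorentzSpace 𝕜 μ (ENNReal.ofReal κ) ∞) (lebesgueSpace 𝕜 μ ∞) v f := by
  refine le_iInf fun f₀ => le_iInf fun _ => le_iInf fun f₁ => le_iInf fun _ => le_iInf fun hf => ?_
  have h := ofReal_rpow_mul_rearrangement_le_lorentz 𝕜 μ hκ f₀ (t := v ^ κ) (by positivity)
  rw [← Real.rpow_mul hv.le, mul_one_div_cancel hκ.ne', Real.rpow_one] at h
  calc ENNReal.ofReal v * rearrangement f (v ^ κ)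
      ≤ ENNReal.ofReal v * (rearrangement f₀ (v ^ κ) + eLpNorm f₁ ∞ μ) := by
        rw [hf]
        exact mul_le_mul_right (rearrangement_add_le _ _ _) _
    _ ≤ _ := by
        rw [mul_add]
        exact add_le_add_left h _

theorem kFunctional_lorentz_le_lebesgue {κ : ℝ} (hκ : 0 < κ) (f : Ω →ₘ[μ] 𝕜) (v : ℝ) :
    kFunctional (lorentzSpace 𝕜 μ (ENNReal.ofReal κ) ∞) (lebesgueSpace 𝕜 μ ∞) v f ≤
      kFunctional (lebesgueSpace 𝕜 μ (ENNReal.ofReal κ)) (lebesgueSpace 𝕜 μ ∞) v f := by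
  refine le_iInf fun f₀ => le_iInf fun h₀ => le_iInf fun f₁ => le_iInf fun h₁ =>
    le_iInf fun hf => ?_
  exact iInf_le_of_le f₀ <| iInf_le_of_le ((lorentz_qnorm_le_lebesgue 𝕜 μ hκ f₀).trans_lt h₀) <|
    iInf_le_of_le f₁ <| iInf_le_of_le h₁ <| iInf_le_of_le hf <|
      add_le_add_left (lorentz_qnorm_le_lebesgue 𝕜 μ hκ f₀) _

/-! ### Embeddings between interpolation spaces -/

theorem kFunctional_eq_top {V : Type*} [Add V] {A₀ A₁ : QSpace V} {f : V}
    (hf : f ∉ sumSet A₀ A₁) (t : ℝ) : kFunctional A₀ A₁ t f = ∞ := by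
  simp only [kFunctional, iInf_eq_top]
  exact fun f₀ h₀ f₁ h₁ h => absurd ⟨f₀, h₀, f₁, h₁, h⟩ hf

theorem mem_llInterpolation_iff {V : Type*} [Add V] {A₀ A₁ : QSpace V} {θ : ℝ} {s r q : ℝ≥0∞}
    (hs : 0 < s) (hr : 0 < r) (hq : 0 < q) {c b a : ℝ → ℝ}
    (hc : SlowlyVarying c) (hb : SlowlyVarying b) (ha : SlowlyVarying a) {f : V} :
    f ∈ (llInterpolation A₀ A₁ θ s c r b q a).carrier ↔
      (llInterpolation A₀ A₁ θ s c r b q a).qnorm f < ∞ := by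
  refine ⟨fun h => h.2, fun h => ⟨?_, h⟩⟩
  by_contra hf
  exact h.ne (llNorm_eq_top hs hr hq hc hb ha fun t _ => kFunctional_eq_top hf t)

theorem QSpace.Embeds.of_qnorm_le {V : Type*} {X Y : QSpace V}
    (hX : ∀ f, f ∈ X.carrier ↔ X.qnorm f < ∞) (hY : ∀ f, f ∈ Y.carrier ↔ Y.qnorm f < ∞)
    (C : ℝ≥0) (h : ∀ f, Y.qnorm f ≤ C * X.qnorm f) : X.Embeds Y :=
  ⟨fun f hf => (hY f).2 ((h f).trans_lt (ENNReal.mul_lt_top ENNReal.coe_lt_top ((hX f).1 hf))),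
    C, fun f _ => h f⟩

theorem QSpace.Embeds.trans {V : Type*} {X Y Z : QSpace V} (h₁ : X.Embeds Y) (h₂ : Y.Embeds Z) :
    X.Embeds Z := by
  obtain ⟨hXY, C, hC⟩ := h₁
  obtain ⟨hYZ, D, hD⟩ := h₂
  refine ⟨hXY.trans hYZ, D * C, fun f hf => (hD f (hXY hf)).trans ?_⟩
  rw [ENNReal.coe_mul, mul_assoc]
  exact mul_le_mul_right (hC f hf) _

/-- The factor v raises the exponent by one. After division by κ the resulting 1 - θ is 1/p. -/
theorem llNorm_mul_ofReal {θ : ℝ} {s r q : ℝ≥0∞} {c b a : ℝ → ℝ} (F : ℝ → ℝ≥0∞) :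
    llNorm (-θ) s c r b q a (fun v => ENNReal.ofReal v * F v) =
      llNorm (1 - θ) s c r b q a F := by
  refine wnorm_congr measurableSet_Ioi fun t _ => ?_
  congr 1
  refine wnorm_congr measurableSet_Ioo fun u _ => ?_
  congr 1
  refine wnorm_congr measurableSet_Ioo fun v hv => ?_
  have hv0 : 0 < v := hv.1
  rw [← mul_assoc, ← ENNReal.ofReal_mul' hv0.le]
  congr 2
  rw [show 1 - θ - (q⁻¹).toReal = (-θ - (q⁻¹).toReal) + 1 by ring, Real.rpow_add_one hv0.ne']
  ring

end

end LorentzKaramata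

open LorentzKaramata in
theorem theorem5p3 {Ω : Type*} [MeasurableSpace Ω] (𝕜 : Type*) [RCLike 𝕜]
    (μ : Measure Ω) [SigmaFinite μ] (hμ : LorentzKaramata.NonAtomic μ)
    (θ κ : ℝ) (hθ₀ : 0 < θ) (hθ₁ : θ ≤ 1) (hκ : 0 < κ)
    (p : ℝ≥0∞) (hp : p = ENNReal.ofReal κ / ENNReal.ofReal (1 - θ))
    (q r s : ℝ≥0∞) (hq : 0 < q) (hr : 0 < r) (hs : 0 < s)
    (a b c : ℝ → ℝ) (ha : LorentzKaramata.SlowlyVarying a)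
    (hb : LorentzKaramata.SlowlyVarying b) (hc : LorentzKaramata.SlowlyVarying c) :
    (LorentzKaramata.llInterpolation
        (LorentzKaramata.lebesgueSpace 𝕜 μ (ENNReal.ofReal κ))
        (LorentzKaramata.lebesgueSpace 𝕜 μ ∞) θ s c r b q a).Identical
      (LorentzKaramata.llInterpolation
        (LorentzKaramata.lorentzSpace 𝕜 μ (ENNReal.ofReal κ) ∞)
        (LorentzKaramata.lebesgueSpace 𝕜 μ ∞) θ s c r b q a) ∧
    (LorentzKaramata.llInterpolation
        (LorentzKaramata.lorentzSpace 𝕜 μ (ENNReal.ofReal κ) ∞)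
        (LorentzKaramata.lebesgueSpace 𝕜 μ ∞) θ s c r b q a).Identical
      (LorentzKaramata.llSpace 𝕜 μ p s (LorentzKaramata.dil κ c) r (LorentzKaramata.dil κ b)
        q (LorentzKaramata.dil κ a)) := by
  -- This includes θ = 1, where p = ∞ and both sides vanish.
  have hpinv : (p⁻¹).toReal = (1 - θ) / κ := by
    rw [hp, ENNReal.inv_div (Or.inl ENNReal.ofReal_ne_top) (Or.inr (by simpa using hκ)),
      ENNReal.toReal_div, ENNReal.toReal_ofReal (by linarith), ENNReal.toReal_ofReal hκ.le]
  have hI : ∀ A₀ A₁ : QSpace (Ω →ₘ[μ] 𝕜), ∀ f,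
      f ∈ (llInterpolation A₀ A₁ θ s c r b q a).carrier ↔
        (llInterpolation A₀ A₁ θ s c r b q a).qnorm f < ∞ := fun A₀ A₁ f =>
    mem_llInterpolation_iff hs hr hq hc hb ha
  have hL : ∀ f, f ∈ (llSpace 𝕜 μ p s (dil κ c) r (dil κ b) q (dil κ a)).carrier ↔
      (llSpace 𝕜 μ p s (dil κ c) r (dil κ b) q (dil κ a)).qnorm f < ∞ := fun f => Iff.rfl
  obtain ⟨k, hk, hdil⟩ := llNorm_dil hs hr hq hκ
  have hqnorm : ∀ f : Ω →ₘ[μ] 𝕜,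
      (llSpace 𝕜 μ p s (dil κ c) r (dil κ b) q (dil κ a)).qnorm f =
        k * llNorm (-θ) s c r b q a
          (fun v => ENNReal.ofReal v * rearrangement f (v ^ κ)) := fun f => by
    rw [llNorm_mul_ofReal, ← hdil, ← hpinv]
    rfl
  have h₁₂ : (llInterpolation (lebesgueSpace 𝕜 μ (ENNReal.ofReal κ)) (lebesgueSpace 𝕜 μ ∞)
      θ s c r b q a).Embeds (llInterpolation (lorentzSpace 𝕜 μ (ENNReal.ofReal κ) ∞)
        (lebesgueSpace 𝕜 μ ∞) θ s c r b q a) :=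
    .of_qnorm_le (hI _ _) (hI _ _) 1 fun f => llNorm_mono 1 fun v _ => by
      simpa using kFunctional_lorentz_le_lebesgue 𝕜 μ hκ f v
  have h₂₃ : (llInterpolation (lorentzSpace 𝕜 μ (ENNReal.ofReal κ) ∞) (lebesgueSpace 𝕜 μ ∞)
      θ s c r b q a).Embeds (llSpace 𝕜 μ p s (dil κ c) r (dil κ b) q (dil κ a)) :=
    .of_qnorm_le (hI _ _) hL k fun f => by
      rw [hqnorm]
      refine mul_le_mul_right ?_ _
      rw [← one_mul (QSpace.qnorm _ f)]
      exact llNorm_mono 1 fun v hv => by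
        simpa using ofReal_mul_rearrangement_le_kFunctional 𝕜 μ hκ f hv
  have h₃₁ : (llSpace 𝕜 μ p s (dil κ c) r (dil κ b) q (dil κ a)).Embeds
      (llInterpolation (lebesgueSpace 𝕜 μ (ENNReal.ofReal κ)) (lebesgueSpace 𝕜 μ ∞)
        θ s c r b q a) := by
    obtain ⟨C, hC⟩ := wnorm_kFunctional_lebesgue_le 𝕜 μ hκ hθ₀ hq ha
    -- k⁻¹ undoes the constant of the substitution t = x^κ.
    refine .of_qnorm_le hL (hI _ _) (C * k⁻¹) fun f => ?_
    have hk' : (k : ℝ≥0∞) ≠ 0 := by simpa using hk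
    rw [hqnorm, ENNReal.coe_mul, ENNReal.coe_inv hk, mul_assoc, ← mul_assoc _ (k : ℝ≥0∞),
      ENNReal.inv_mul_cancel hk' ENNReal.coe_ne_top, one_mul]
    exact llNorm_mono_inner C (hC f)
  exact ⟨⟨h₁₂, h₂₃.trans h₃₁⟩, h₂₃, h₃₁.trans h₁₂⟩
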